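/- Let $d\ge 2$, $n\ge 1$ be integers, let $B_d=\{x\in\mathbb R^d:\|x\|_2\le 1\}$, and let $\mathbb P_n$ be the space of real $d$-variate polynomials of total degree at most $n$. For a set $Y$ write $\|g\|_Y=\sup_{x\in Y}|g(x)|$. Let $\mathcal C_k$ denote either, for all $k\ge1$, the $k$ Chebyshev points $\cos\frac{(2j-1)\pi}{2k}$, $1\le j\le k$, or, for all $k\ge 1$, the $k+1$ Chebyshev–Lobatto points $\cos\frac{j\pi}{k}$, $0\le j\le k$. For $b-a\le 2\pi$ put $\sigma_{a,b}(u)=2\arcsin\!\big(\sin(\tfrac{b-a}{4})\,u\big)+\tfrac{a+b}{2}$ for $u\in[-1,1]$, and let $\mathcal S=\mathcal G\circ\mathcal U:[-1,1]^d\to B_d$, where $$\mathcal U(u_1,\dots,u_d)=\Big(\tfrac{u_1}{2}+\tfrac12,\ \sigma_{0,\pi}(u_2),\dots,\sigma_{0,\pi}(u_{d-1}),\ \sigma_{0,2\pi}(u_d)\Big)$$ and $\mathcal G(r,\theta_1,\dots,\theta_{d-1})=(x_1,\dots,x_d)$ with $$x_j=r\cos\theta_j\prod_{k=1}^{j-1}\sin\theta_k\quad(1\le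 j\le d-1),\qquad x_d=r\prod_{k=1}^{d-1}\sin\theta_k .$$ Let $m>1$ be such that $mn$ is an integer (for instance, $m\ge2$ an integer), and set $X_n^m=\mathcal S\big(\mathcal C_{mn}\times(\mathcal C_{2mn})^{d-1}\big)$ and $c_m=1/\cos(\pi/(2m))$. Let $L_n:C(B_d)\to\mathbb P_n$ be a linear projection operator (that is, $L_n$ is linear and $L_np=p$ for every $p\in\mathbb P_n$) of the form $$L_nf(x)=\sum_{i=1}^M f(\xi_i)\,\varphi_i(x),$$ where $\xi_1,\dots,\xi_M\in B_d$ are distinct and $\{\varphi_1,\dots,\varphi_M\}$ is a set of generators of $\mathbb P_n$. Let $\lambda_n(x)=\sum_{i=1}^M|\varphi_i(x)|$ be its Lebesgue function and $\|L_n\|=\sup_{f\ne0}\|L_nf\|_{B_d}/\|f\|_{B_d}$ its Lebesgue constant. Then $\|L_n\|$ is finite, $\|L_n\|=\|\lambda_n\|_{B_d}$, and $$\|\lambda_n\|_{X_n^m}\ \le\ \|L_n\|\ \le\ (c_m)^d\,\|\lambda_n\|_{X_n^m}.$$ -/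

import Mathlib

open scoped BigOperators

noncomputable section

/-- The constant `c_m = 1 / cos (π / (2 m))`. -/
def chebConst (m : ℝ) : ℝ := 1 / Real.cos (Real.pi / (2 * m))

/-- The `k` Chebyshev zeros `cos ((2 j - 1) π / (2 k))`, `1 ≤ j ≤ k`. -/
def chebZeros (k : ℕ) : Set ℝ :=
  {x | ∃ j : ℕ, 1 ≤ j ∧ j ≤ k ∧ x = Real.cos ((2 * (j : ℝ) - 1) * Real.pi / (2 * (k : ℝ)))}

/-- The `k + 1` Chebyshev extrema (Chebyshev-Lobatto points) `cos (j π / k)`, `0 ≤ j ≤ k`. -/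
def chebExtrema (k : ℕ) : Set ℝ :=
  {x | ∃ j : ℕ, j ≤ k ∧ x = Real.cos ((j : ℝ) * Real.pi / (k : ℝ))}

/-- The angle map `σ_{a,b}(u) = 2 arcsin (α u) + β`, with `α = sin ((b - a) / 4)` and
`β = (b + a) / 2`. -/
def sigmaMap (a b u : ℝ) : ℝ := 2 * Real.arcsin (Real.sin ((b - a) / 4) * u) + (b + a) / 2

/-- Generalized spherical coordinates for `d ≥ 2`. The radius is `r = t 0` and the angles are
`θ_k = t k` for `1 ≤ k ≤ d - 1`. The Cartesian coordinate with (zero-based) index `i < d - 1` is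
`r cos θ_{i+1} sin θ_1 ⋯ sin θ_i`, and the last one is `r sin θ_1 ⋯ sin θ_{d-1}`. -/
def sphericalMap {d : ℕ} (t : Fin d → ℝ) : EuclideanSpace ℝ (Fin d) :=
  WithLp.toLp 2 fun i : Fin d =>
    t ⟨0, i.pos⟩ * (if h : i.val + 1 < d then Real.cos (t ⟨i.val + 1, h⟩) else 1) *
      ∏ k ∈ Finset.univ.filter (fun k : Fin d => 1 ≤ k.val ∧ k.val ≤ i.val), Real.sin (t k)

/-- The map `(u_1, …, u_d) ↦ (u_1 / 2 + 1 / 2, σ_{0,π}(u_2), …, σ_{0,π}(u_{d-1}), σ_{0,2π}(u_d))`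
for `d ≥ 2`. -/
def paramMap {d : ℕ} (u : Fin d → ℝ) : Fin d → ℝ := fun i =>
  if i.val = 0 then u i / 2 + 1 / 2
  else if i.val + 1 = d then sigmaMap 0 (2 * Real.pi) (u i)
  else sigmaMap 0 Real.pi (u i)

/-- The mesh `S (C_k × (C_{2k})^{d-1})`, where `S` is the composition of the two maps above and
`C` is a family of point sets in `[-1, 1]`. -/
def ballMesh (C : ℕ → Set ℝ) (d k : ℕ) : Set (EuclideanSpace ℝ (Fin d)) :=
  (fun u : Fin d → ℝ => sphericalMap (paramMap u)) ''
    {u | ∀ i : Fin d, u i ∈ if i.val = 0 then C k else C (2 * k)}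

/-- The closed Euclidean unit ball of `ℝ^d`. -/
abbrev unitBall (d : ℕ) : Set (EuclideanSpace ℝ (Fin d)) := Metric.closedBall 0 1

/-- Real polynomials in `d` variables of total degree at most `n`. -/
abbrev polySpace (d n : ℕ) : Submodule ℝ (MvPolynomial (Fin d) ℝ) :=
  MvPolynomial.restrictTotalDegree (Fin d) ℝ n

/-- The value of a polynomial at a point of Euclidean space. -/
def polyEval {d : ℕ} (p : MvPolynomial (Fin d) ℝ) (x : EuclideanSpace ℝ (Fin d)) : ℝ :=
  MvPolynomial.eval (fun i => x i) p

/-- The restriction of a polynomial to the unit ball, as a continuous function. -/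
def polyOnBall {d : ℕ} (p : MvPolynomial (Fin d) ℝ) : C(unitBall d, ℝ) where
  toFun x := polyEval p x.1
  continuous_toFun := by
    unfold polyEval
    exact (MvPolynomial.continuous_eval p).comp (by fun_prop)

/-- The sup-norm `‖g‖_Y` of a function on a set. -/
def supNormOn {α : Type*} (Y : Set α) (g : α → ℝ) : ℝ := sSup ((fun x => |g x|) '' Y)

/-- The Lebesgue function `λ(x) = ∑ i, |φ_i(x)|`. -/
def lebesgueFn {d n M : ℕ} (φ : Fin M → polySpace d n) (x : EuclideanSpace ℝ (Fin d)) : ℝ :=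
  ∑ i, |polyEval (φ i : MvPolynomial (Fin d) ℝ) x|

/-- The quotients `‖L f‖ / ‖f‖`, `f ≠ 0`, in the sup-norm of the ball. -/
def normQuotients {d n : ℕ} (L : C(unitBall d, ℝ) →ₗ[ℝ] polySpace d n) : Set ℝ :=
  {q | ∃ f : C(unitBall d, ℝ), f ≠ 0 ∧
    q = ‖polyOnBall (L f : MvPolynomial (Fin d) ℝ)‖ / ‖f‖}

/-- The uniform norm (Lebesgue constant) `‖L‖ = sup_{f ≠ 0} ‖L f‖ / ‖f‖`. -/
def lebesgueConst {d n : ℕ} (L : C(unitBall d, ℝ) →ₗ[ℝ] polySpace d n) : ℝ :=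
  sSup (normQuotients L)

end

/-! The mesh is norming for `ℙ_n` on the ball with constant `c_m ^ d`; the bound passes from
polynomials to `λ_n` by a choice of signs. One variable: if a trigonometric polynomial `f` of degree
`n` attains its maximum modulus at `s`, then M. Riesz's inequality gives `|f θ| ≥ |f s| cos (n (θ -
s))` for `|θ - s| < π / n` (`mul_cos_le_of_isMax`). A mesh angle within `π / (2 m n)` of `s`
therefore loses at most the factor `c_m`. The Chebyshev points, and their images under `σ`, are that
dense in angle (`IsCosDense.exists_sigmaMap`). Several variables: in spherical coordinates a
polynomial of degree `n` is trigonometric of degree `n` in each angle, and also in `τ` when `r = (1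
+ cos τ) / 2`. Coordinates enter the mesh one at a time. At each step the earlier ones stay fixed,
all the others are chosen to maximise `|p|`, and only the current one is then moved
(`exists_mesh_step`). After `d` steps the cost is `c_m ^ d`. Lebesgue function: for fixed `x`, the
polynomial `p = ∑ sign (φ_i x) φ_i` satisfies `p x = λ_n x` and `|p| ≤ λ_n` everywhere, so the
norming inequality for `p` gives the one for `λ_n`. The identity `‖L‖ = ‖λ_n‖` follows from a Tietze
extension of the same signs prescribed at the nodes. -/

/-! ### Trigonometric polynomials and M. Riesz's inequality. -/

/-- `f` is a real trigonometric polynomial of degree at most `n`. -/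
def IsTrigPoly (n : ℕ) (f : ℝ → ℝ) : Prop :=
  ∃ P : Polynomial ℂ, P.natDegree ≤ 2 * n ∧
    ∀ θ : ℝ, Complex.exp (θ * Complex.I) ^ n * (f θ : ℂ) = P.eval (Complex.exp (θ * Complex.I))

namespace IsTrigPoly

theorem const (c : ℝ) : IsTrigPoly 0 fun _ => c :=
  ⟨Polynomial.C (c : ℂ), by simp, fun θ => by simp⟩

theorem mul {a b : ℕ} {f g : ℝ → ℝ} (hf : IsTrigPoly a f) (hg : IsTrigPoly b g) :
    IsTrigPoly (a + b) fun θ => f θ * g θ := by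
  obtain ⟨P, hP, hP'⟩ := hf
  obtain ⟨Q, hQ, hQ'⟩ := hg
  refine ⟨P * Q, Polynomial.natDegree_mul_le.trans (by omega), fun θ => ?_⟩
  rw [Polynomial.eval_mul, ← hP', ← hQ']
  push_cast
  ring

theorem mono {a b : ℕ} {f : ℝ → ℝ} (hf : IsTrigPoly a f) (h : a ≤ b) : IsTrigPoly b f := by
  obtain ⟨P, hP, hP'⟩ := hf
  refine ⟨Polynomial.X ^ (b - a) * P, ?_, fun θ => ?_⟩
  · refine Polynomial.natDegree_mul_le.trans ?_
    rw [Polynomial.natDegree_X_pow]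
    omega
  · rw [Polynomial.eval_mul, ← hP', Polynomial.eval_pow, Polynomial.eval_X, ← mul_assoc, ← pow_add]
    congr 3
    omega

theorem add {n : ℕ} {f g : ℝ → ℝ} (hf : IsTrigPoly n f) (hg : IsTrigPoly n g) :
    IsTrigPoly n fun θ => f θ + g θ := by
  obtain ⟨P, hP, hP'⟩ := hf
  obtain ⟨Q, hQ, hQ'⟩ := hg
  refine ⟨P + Q, (Polynomial.natDegree_add_le _ _).trans (max_le hP hQ), fun θ => ?_⟩
  rw [Polynomial.eval_add, ← hP', ← hQ']
  push_cast
  ring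

theorem const_mul {n : ℕ} {f : ℝ → ℝ} (hf : IsTrigPoly n f) (c : ℝ) :
    IsTrigPoly n fun θ => c * f θ := by
  simpa using (const c).mul hf

theorem sum {ι : Type*} (s : Finset ι) {n : ℕ} {f : ι → ℝ → ℝ}
    (hf : ∀ i ∈ s, IsTrigPoly n (f i)) : IsTrigPoly n fun θ => ∑ i ∈ s, f i θ := by
  classical
  induction s using Finset.induction_on with
  | empty => simpa using (const 0).mono (Nat.zero_le n)
  | insert a s ha ih =>
    simp only [Finset.sum_insert ha]
    exact (hf a (by simp)).add (ih fun i hi => hf i (by simp [hi]))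

theorem pow {n : ℕ} {f : ℝ → ℝ} (hf : IsTrigPoly n f) (k : ℕ) :
    IsTrigPoly (k * n) fun θ => f θ ^ k := by
  induction k with
  | zero => simpa using const 1
  | succ k ih => simpa only [pow_succ, Nat.succ_mul] using ih.mul hf

theorem prod {ι : Type*} (s : Finset ι) {n : ι → ℕ} {f : ι → ℝ → ℝ}
    (hf : ∀ i ∈ s, IsTrigPoly (n i) (f i)) :
    IsTrigPoly (∑ i ∈ s, n i) fun θ => ∏ i ∈ s, f i θ := by
  classical
  induction s using Finset.induction_on with
  | empty => simpa using const 1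
  | insert a s ha ih =>
    simp only [Finset.prod_insert ha, Finset.sum_insert ha]
    exact (hf a (by simp)).mul (ih fun i hi => hf i (by simp [hi]))

theorem cos_nat_mul_add (n : ℕ) (c : ℝ) : IsTrigPoly n fun θ => Real.cos (n * θ + c) := by
  refine ⟨Polynomial.C (Complex.exp (c * Complex.I) / 2) * Polynomial.X ^ (2 * n) +
    Polynomial.C (Complex.exp (-c * Complex.I) / 2), ?_, fun θ => ?_⟩
  · refine (Polynomial.natDegree_add_C).le.trans ?_
    exact Polynomial.natDegree_C_mul_X_pow_le _ _
  · simp only [Polynomial.eval_add, Polynomial.eval_mul, Polynomial.eval_C, Polynomial.eval_pow,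
      Polynomial.eval_X, Complex.ofReal_cos, Complex.cos, ← Complex.exp_nat_mul]
    rw [div_mul_eq_mul_div, ← Complex.exp_add, ← add_div, mul_div_assoc', mul_add, ← Complex.exp_add,
      ← Complex.exp_add]
    congr 3 <;> push_cast <;> ring_nf

theorem cos : IsTrigPoly 1 Real.cos := by
  simpa using cos_nat_mul_add 1 0

theorem sin : IsTrigPoly 1 Real.sin := by
  simpa [← sub_eq_add_neg, Real.cos_sub_pi_div_two] using cos_nat_mul_add 1 (-(Real.pi / 2))

/-- Since `f` is real, conjugating the identity at `-θ` returns to `exp (iθ)` with conjugated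
coefficients. -/
theorem comp_neg {n : ℕ} {f : ℝ → ℝ} (hf : IsTrigPoly n f) : IsTrigPoly n fun θ => f (-θ) := by
  obtain ⟨P, hP, hP'⟩ := hf
  refine ⟨P.map (starRingEnd ℂ), Polynomial.natDegree_map_le.trans hP, fun θ => ?_⟩
  have h := congrArg (starRingEnd ℂ) (hP' (-θ))
  rw [← Polynomial.eval_map_apply] at h
  simpa [← Complex.exp_conj] using h

theorem continuous {n : ℕ} {f : ℝ → ℝ} (hf : IsTrigPoly n f) : Continuous f := by
  obtain ⟨P, -, hP'⟩ := hf
  have : f = fun θ : ℝ => (P.eval (Complex.exp (θ * Complex.I)) /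
      Complex.exp (θ * Complex.I) ^ n).re := by
    funext θ
    rw [← hP', mul_div_cancel_left₀ _ (pow_ne_zero _ (Complex.exp_ne_zero _)), Complex.ofReal_re]
  rw [this]
  refine Complex.continuous_re.comp (Continuous.div ?_ (by fun_prop)
    fun θ => pow_ne_zero _ (Complex.exp_ne_zero _))
  exact P.continuous.comp (by fun_prop)

/-- A trigonometric polynomial of degree at most `n` with more than `2 n` zeros in a period
vanishes. -/
theorem eq_zero_of_card {n : ℕ} {f : ℝ → ℝ} (hf : IsTrigPoly n f) {Z : Finset ℝ} {a : ℝ}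
    (hZ : ∀ z ∈ Z, z ∈ Set.Ico a (a + 2 * Real.pi)) (h0 : ∀ z ∈ Z, f z = 0)
    (hcard : 2 * n < Z.card) (θ : ℝ) : f θ = 0 := by
  obtain ⟨P, hP, hP'⟩ := hf
  have hinj : Set.InjOn (fun z : ℝ => Complex.exp (z * Complex.I)) (Z : Set ℝ) := by
    intro z hz w hw h
    obtain ⟨N, hN⟩ := Complex.exp_eq_exp_iff_exists_int.1 h
    have hN' : z = w + N * (2 * Real.pi) := by
      have h1 : (z : ℂ) * Complex.I = ((w + N * (2 * Real.pi) : ℝ) : ℂ) * Complex.I := by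
        rw [hN]; push_cast; ring
      exact_mod_cast mul_right_cancel₀ Complex.I_ne_zero h1
    have hz' := hZ z hz
    have hw' := hZ w hw
    have hpi := Real.pi_pos
    have h1 : (N : ℝ) < 1 := by
      by_contra! h
      nlinarith [hz'.2, hw'.1]
    have h2 : (-1 : ℝ) < N := by
      by_contra! h
      nlinarith [hw'.2, hz'.1]
    have h3 : N = 0 := by
      have h4 : N < 1 := by exact_mod_cast h1
      have h5 : -1 < N := by exact_mod_cast h2
      omega
    simpa [h3] using hN'
  have hP0 : P = 0 := by
    refine Polynomial.eq_zero_of_natDegree_lt_card_of_eval_eq_zero' P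
      (Z.image fun z : ℝ => Complex.exp (z * Complex.I)) ?_ ?_
    · intro w hw
      obtain ⟨z, hz, rfl⟩ := Finset.mem_image.1 hw
      rw [← hP', h0 z hz]
      simp
    · rw [Finset.card_image_of_injOn hinj]
      omega
  have h := hP' θ
  rw [hP0, Polynomial.eval_zero] at h
  exact_mod_cast (mul_eq_zero.1 h).resolve_left (pow_ne_zero _ (Complex.exp_ne_zero _))

/-- The `2 n + 2` points `x 0, …, x (2 n + 1)` lie in less than a period, and their `2 n + 1` sign
changes each force a zero, one too many. Asking for signs at every index is only a convenience. -/
theorem not_alternating {n : ℕ} {f : ℝ → ℝ} (hf : IsTrigPoly n f) {x : ℕ → ℝ} (hx : StrictMono x)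
    (hx' : x (2 * n + 1) < x 0 + 2 * Real.pi) (hs : ∀ i, 0 < (-1) ^ i * f (x i)) : False := by
  have hz : ∀ i, ∃ z ∈ Set.Ioo (x i) (x (i + 1)), f z = 0 := by
    intro i
    have hc : Continuous fun θ => (-1) ^ i * f θ := continuous_const.mul hf.continuous
    have h1 : (-1) ^ i * f (x (i + 1)) < 0 := by
      have := hs (i + 1)
      rw [pow_succ] at this
      linarith
    obtain ⟨z, hz, hz0⟩ := intermediate_value_Ioo' (hx (Nat.lt_succ_self i)).le hc.continuousOn
      (show (0 : ℝ) ∈ _ from ⟨h1, hs i⟩)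
    exact ⟨z, hz, by simpa using hz0⟩
  choose z hzI hz0 using hz
  have hmono : StrictMono z :=
    strictMono_nat_of_lt_succ fun i => (hzI i).2.trans (hzI (i + 1)).1
  have key := hf.eq_zero_of_card (Z := (Finset.range (2 * n + 1)).image z) (a := x 0) ?_ ?_ ?_ (x 0)
  · have := hs 0
    rw [key] at this
    simp at this
  · intro w hw
    obtain ⟨i, hi, rfl⟩ := Finset.mem_image.1 hw
    rw [Finset.mem_range] at hi
    refine ⟨((hx.monotone (Nat.zero_le i)).trans_lt (hzI i).1).le, ?_⟩
    exact ((hzI i).2.trans_le (hx.monotone (by omega))).trans hx'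
  · intro w hw
    obtain ⟨i, hi, rfl⟩ := Finset.mem_image.1 hw
    exact hz0 i
  · rw [Finset.card_image_of_injective _ hmono.injective]
    simp

/-- M. Riesz: near a maximum point, a trigonometric polynomial of degree `n` decays no faster than
`cos (n ·)`. -/
theorem cos_le_of_eq_one {n : ℕ} (hn : 0 < n) {f : ℝ → ℝ} (hf : IsTrigPoly n f)
    (hb : ∀ θ, |f θ| ≤ 1) {s h : ℝ} (hs : f s = 1) (h0 : 0 ≤ h) (h1 : h < Real.pi / n) :
    Real.cos (n * h) ≤ f (s + h) := by
  by_contra! hlt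
  have hn' : (0 : ℝ) < n := by exact_mod_cast hn
  have hpi := Real.pi_pos
  have hpos : 0 < h := by
    rcases h0.eq_or_lt with rfl | h'
    · simp [hs] at hlt
    · exact h'
  -- At `s` the graphs of `f` and `cos (n (· - s))` touch. Shifting the cosine left by `δ` and
  -- shrinking `f` by `1 - ε` replaces this contact by strict sign changes, and the assumed failure
  -- at `s + h` survives if `δ` and `ε` are small.
  obtain ⟨δ, ⟨hδ1, hδ2⟩, hδ⟩ : ∃ δ, (f (s + h) < Real.cos (n * (h + δ)) ∧ h + δ < Real.pi / n) ∧
      0 < δ := by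
    have e1 : ∀ᶠ δ in nhds (0 : ℝ), f (s + h) < Real.cos (n * (h + δ)) :=
      (show ContinuousAt (fun δ => Real.cos (n * (h + δ))) 0 by
        fun_prop).tendsto.eventually_const_lt (by simpa using hlt)
    have e2 : ∀ᶠ δ in nhds (0 : ℝ), h + δ < Real.pi / n :=
      (show ContinuousAt (fun δ => h + δ) 0 by
        fun_prop).tendsto.eventually_lt_const (by simpa using h1)
    exact (((e1.and e2).filter_mono nhdsWithin_le_nhds).and
      (self_mem_nhdsWithin : Set.Ioi (0 : ℝ) ∈ nhdsWithin 0 (Set.Ioi 0))).exists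
  have hnδ : n * δ < Real.pi := by
    have : δ < Real.pi / n := by linarith
    rwa [lt_div_iff₀ hn', mul_comm] at this
  have hcδ : Real.cos (n * δ) < 1 := by
    have := Real.cos_lt_cos_of_nonneg_of_le_pi le_rfl hnδ.le (by positivity)
    simpa using this
  obtain ⟨ε, ⟨⟨hε1, hε2⟩, hε3⟩, hε⟩ : ∃ ε : ℝ, ((Real.cos (n * δ) < 1 - ε ∧
      (1 - ε) * f (s + h) < Real.cos (n * (h + δ))) ∧ ε < 1) ∧ 0 < ε := by
    have e1 : ∀ᶠ ε in nhds (0 : ℝ), Real.cos (n * δ) < 1 - ε :=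
      (show ContinuousAt (fun ε : ℝ => 1 - ε) 0 by
        fun_prop).tendsto.eventually_const_lt (by simpa using hcδ)
    have e2 : ∀ᶠ ε in nhds (0 : ℝ), (1 - ε) * f (s + h) < Real.cos (n * (h + δ)) :=
      (show ContinuousAt (fun ε : ℝ => (1 - ε) * f (s + h)) 0 by
        fun_prop).tendsto.eventually_lt_const (by simpa using hδ1)
    have e3 : ∀ᶠ ε in nhds (0 : ℝ), ε < 1 := eventually_lt_nhds one_pos
    exact ((((e1.and e2).and e3).filter_mono nhdsWithin_le_nhds).and
      (self_mem_nhdsWithin : Set.Ioi (0 : ℝ) ∈ nhdsWithin 0 (Set.Ioi 0))).exists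
  have hfs : ∀ (i : ℕ) (θ : ℝ), (1 - ε) * ((-1) ^ i * f θ) < 1 := by
    intro i θ
    have h2 : (-1) ^ i * f θ ≤ 1 := by
      refine (le_abs_self _).trans ?_
      rw [abs_mul, abs_neg_one_pow, one_mul]
      exact hb θ
    nlinarith
  -- The points `s - δ` and those from index 3 on are extrema of the shifted cosine, where it
  -- dominates `(1 - ε) f`. The points `s` and `s + h`, inserted between the first two extrema,
  -- supply two extra sign changes.
  let x : ℕ → ℝ := fun i => match i with
    | 0 => s - δ
    | 1 => s
    | 2 => s + h
    | i + 3 => s + (i + 1 : ℕ) * (Real.pi / n) - δ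
  have hx : StrictMono x := by
    refine strictMono_nat_of_lt_succ fun i => ?_
    match i with
    | 0 => simp only [x]; linarith
    | 1 => simp only [x]; linarith
    | 2 => simp only [x]; push_cast; linarith
    | i + 3 =>
      have : 0 < Real.pi / n := by positivity
      simp only [x]; push_cast; linarith
  refine IsTrigPoly.not_alternating (n := n)
    (f := fun θ => Real.cos (n * θ + n * (δ - s)) + (-(1 - ε)) * f θ)
    ((cos_nat_mul_add n _).add (hf.const_mul _)) hx ?_ ?_
  · obtain ⟨N, rfl⟩ : ∃ N, n = N + 1 := ⟨n - 1, by omega⟩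
    show s + (2 * N + 1 : ℕ) * (Real.pi / (N + 1 : ℕ)) - δ < s - δ + 2 * Real.pi
    have : (2 * N + 1 : ℕ) * (Real.pi / (N + 1 : ℕ)) < 2 * Real.pi := by
      rw [mul_div_assoc', div_lt_iff₀ hn']
      push_cast
      nlinarith
    linarith
  · intro i
    match i with
    | 0 =>
      have := hfs 0 (s - δ)
      simp only [x]
      rw [show (n : ℝ) * (s - δ) + n * (δ - s) = 0 by ring, Real.cos_zero]
      linarith
    | 1 =>
      simp only [x, hs]
      rw [show (n : ℝ) * s + n * (δ - s) = n * δ by ring]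
      linarith
    | 2 =>
      simp only [x]
      rw [show (n : ℝ) * (s + h) + n * (δ - s) = n * (h + δ) by ring]
      linarith
    | i + 3 =>
      have := hfs (i + 3) (s + (i + 1 : ℕ) * (Real.pi / n) - δ)
      simp only [x]
      rw [show (n : ℝ) * (s + (i + 1 : ℕ) * (Real.pi / n) - δ) + n * (δ - s) = (i + 1 : ℕ) * Real.pi by
        field_simp; ring, Real.cos_nat_mul_pi, mul_add, ← pow_add, Even.neg_one_pow ⟨i + 2, by ring⟩]
      linarith

theorem mul_cos_le_of_isMax {n : ℕ} (hn : 0 < n) {f : ℝ → ℝ} (hf : IsTrigPoly n f) {s : ℝ}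
    (hb : ∀ θ, |f θ| ≤ |f s|) {θ : ℝ} (h : |θ - s| < Real.pi / n) :
    |f s| * Real.cos (n * (θ - s)) ≤ |f θ| := by
  rcases eq_or_ne (f s) 0 with h0 | h0
  · simp [h0]
  have hpos : 0 < |f s| := abs_pos.2 h0
  have hg : IsTrigPoly n fun θ => (f s)⁻¹ * f θ := hf.const_mul _
  have hgb : ∀ θ, |(f s)⁻¹ * f θ| ≤ 1 := fun θ => by
    rw [abs_mul, abs_inv, inv_mul_le_iff₀ hpos, mul_one]
    exact hb θ
  have key : Real.cos (n * (θ - s)) ≤ (f s)⁻¹ * f θ := by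
    rcases le_total s θ with hle | hle
    · have := hg.cos_le_of_eq_one hn hgb (s := s) (h := θ - s) (inv_mul_cancel₀ h0)
        (by linarith) ((le_abs_self _).trans_lt h)
      simpa using this
    -- The left side of the maximum is the right side for the reflected polynomial.
    · have := hg.comp_neg.cos_le_of_eq_one hn (fun θ => hgb (-θ)) (s := -s) (h := s - θ)
        (by simp [h0]) (by linarith) (by rw [abs_sub_comm] at h; exact (le_abs_self _).trans_lt h)
      rw [show (n : ℝ) * (θ - s) = -(n * (s - θ)) by ring, Real.cos_neg]
      simpa using this
  calc |f s| * Real.cos (n * (θ - s)) ≤ |f s| * |(f s)⁻¹ * f θ| :=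
        mul_le_mul_of_nonneg_left (key.trans (le_abs_self _)) hpos.le
    _ = |f θ| := by rw [← abs_mul, mul_inv_cancel_left₀ h0]

theorem mvPolynomial_eval {σ : Type*} [Fintype σ] {n : ℕ} {p : MvPolynomial σ ℝ}
    (hp : p.totalDegree ≤ n) {g : σ → ℝ → ℝ} (hg : ∀ i, IsTrigPoly 1 (g i)) :
    IsTrigPoly n fun θ => MvPolynomial.eval (fun i => g i θ) p := by
  simp only [MvPolynomial.eval_eq']
  refine sum _ fun s hs => const_mul ?_ _
  refine (prod Finset.univ fun i _ => (hg i).pow (s i)).mono ?_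
  refine le_trans ?_ ((MvPolynomial.le_totalDegree hs).trans hp)
  rw [Finsupp.sum_fintype _ _ fun _ => rfl]
  simp

end IsTrigPoly

/-! ### Angular density of the Chebyshev points and of their images under `σ`. -/

/-- Every angle in `[0, π]` is within `π / (2 k)` of an angle of `[0, π]` whose cosine lies in
`C k`. -/
def IsCosDense (C : ℕ → Set ℝ) : Prop :=
  ∀ k : ℕ, 0 < k → ∀ t ∈ Set.Icc 0 Real.pi, ∃ s ∈ Set.Icc 0 Real.pi,
    Real.cos s ∈ C k ∧ |s - t| ≤ Real.pi / (2 * k)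

theorem isCosDense_chebZeros : IsCosDense chebZeros := by
  intro k hk t ht
  have hk' : (0 : ℝ) < k := by exact_mod_cast hk
  have hpi := Real.pi_pos
  set y := t * k / Real.pi with hy
  have hty : t = y * Real.pi / k := by rw [hy]; field_simp
  have hy0 : 0 ≤ y := by have := ht.1; positivity
  have hyk : y ≤ k := by
    rw [hy, div_le_iff₀ hpi, mul_comm]
    exact mul_le_mul_of_nonneg_left ht.2 hk'.le
  -- In units of `π / k` the nodes are the midpoints `j - 1/2` of the intervals `[j - 1, j]`; the
  -- endpoint `y = k` belongs to the last interval.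
  obtain ⟨j, hj1, hjk, hjy, hyj⟩ : ∃ j : ℕ, 1 ≤ j ∧ j ≤ k ∧ (j : ℝ) - 1 ≤ y ∧ y ≤ j := by
    rcases hyk.eq_or_lt with h | h
    · exact ⟨k, hk, le_rfl, by linarith, h.le⟩
    · have hf : ⌊y⌋₊ < k := (Nat.floor_lt hy0).2 h
      refine ⟨⌊y⌋₊ + 1, by omega, by omega, ?_, ?_⟩
      · push_cast
        linarith [Nat.floor_le hy0]
      · push_cast
        exact (Nat.lt_floor_add_one y).le
  have hj1' : (1 : ℝ) ≤ j := by exact_mod_cast hj1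
  have hjk' : (j : ℝ) ≤ k := by exact_mod_cast hjk
  refine ⟨(2 * (j : ℝ) - 1) * Real.pi / (2 * (k : ℝ)), ⟨?_, ?_⟩, ⟨j, hj1, hjk, rfl⟩, ?_⟩
  · have : 0 ≤ 2 * (j : ℝ) - 1 := by linarith
    positivity
  · rw [div_le_iff₀ (by positivity)]
    nlinarith
  · rw [hty, show (2 * (j : ℝ) - 1) * Real.pi / (2 * k) - y * Real.pi / k =
      (2 * (j - y) - 1) * (Real.pi / (2 * k)) by field_simp; ring, abs_mul,
      abs_of_pos (show 0 < Real.pi / (2 * k) by positivity)]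
    refine mul_le_of_le_one_left (by positivity) (abs_le.2 ⟨?_, ?_⟩) <;> linarith

theorem isCosDense_chebExtrema : IsCosDense chebExtrema := by
  intro k hk t ht
  have hk' : (0 : ℝ) < k := by exact_mod_cast hk
  have hpi := Real.pi_pos
  set y := t * k / Real.pi with hy
  have hty : t = y * Real.pi / k := by rw [hy]; field_simp
  have hy0 : 0 ≤ y := by have := ht.1; positivity
  have hyk : y ≤ k := by
    rw [hy, div_le_iff₀ hpi, mul_comm]
    exact mul_le_mul_of_nonneg_left ht.2 hk'.le
  obtain ⟨j, hjk, hjy, hyj⟩ : ∃ j : ℕ, j ≤ k ∧ (j : ℝ) ≤ y + 1 / 2 ∧ y + 1 / 2 ≤ j + 1 := by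
    have hf : ⌊y + 1 / 2⌋₊ < k + 1 := (Nat.floor_lt (by positivity)).2 (by push_cast; linarith)
    exact ⟨⌊y + 1 / 2⌋₊, by omega, Nat.floor_le (by positivity), (Nat.lt_floor_add_one _).le⟩
  have hjk' : (j : ℝ) ≤ k := by exact_mod_cast hjk
  refine ⟨(j : ℝ) * Real.pi / (k : ℝ), ⟨by positivity, ?_⟩, ⟨j, hjk, rfl⟩, ?_⟩
  · rw [div_le_iff₀ hk']
    nlinarith
  · rw [hty, show (j : ℝ) * Real.pi / k - y * Real.pi / k =
      (2 * (j - y)) * (Real.pi / (2 * k)) by field_simp, abs_mul,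
      abs_of_pos (show 0 < Real.pi / (2 * k) by positivity)]
    refine mul_le_of_le_one_left (by positivity) (abs_le.2 ⟨?_, ?_⟩) <;> linarith

theorem chebZeros_subset (k : ℕ) : chebZeros k ⊆ Set.Icc (-1) 1 := by
  rintro _ ⟨j, -, -, rfl⟩
  exact Real.cos_mem_Icc _

theorem chebExtrema_subset (k : ℕ) : chebExtrema k ⊆ Set.Icc (-1) 1 := by
  rintro _ ⟨j, -, rfl⟩
  exact Real.cos_mem_Icc _

/-- The cosine is decreasing on `[0, π]`, so the Lipschitz bound amounts to comparing the cosines of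
the two differences. After the addition formulas this is Cauchy–Schwarz. -/
theorem abs_arcsin_mul_cos_sub_le {α : ℝ} (hα : |α| ≤ 1) {s t : ℝ} (hs : s ∈ Set.Icc 0 Real.pi)
    (ht : t ∈ Set.Icc 0 Real.pi) :
    |Real.arcsin (α * Real.cos s) - Real.arcsin (α * Real.cos t)| ≤ |s - t| := by
  have hα2 : α ^ 2 ≤ 1 := (sq_le_one_iff_abs_le_one _).2 hα
  have hb : ∀ r, |α * Real.cos r| ≤ 1 := fun r => by
    rw [abs_mul]
    exact mul_le_one₀ hα (abs_nonneg _) (Real.abs_cos_le_one r)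
  have hst : |s - t| ≤ Real.pi := abs_le.2 ⟨by linarith [hs.1, ht.2], by linarith [hs.2, ht.1]⟩
  have hmem := Real.arcsin_mem_Icc (α * Real.cos s)
  have hmem' := Real.arcsin_mem_Icc (α * Real.cos t)
  by_contra! hlt
  have hcos := Real.cos_lt_cos_of_nonneg_of_le_pi (abs_nonneg _)
    (abs_le.2 ⟨by linarith [hmem.1, hmem'.2], by linarith [hmem.2, hmem'.1]⟩) hlt
  rw [Real.cos_abs, Real.cos_abs, Real.cos_sub, Real.cos_sub, Real.cos_arcsin, Real.cos_arcsin,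
    Real.sin_arcsin (abs_le.1 (hb s)).1 (abs_le.1 (hb s)).2,
    Real.sin_arcsin (abs_le.1 (hb t)).1 (abs_le.1 (hb t)).2, ← Real.sqrt_mul
      (by nlinarith [abs_le.1 (hb s)])] at hcos
  -- Cauchy–Schwarz for the vectors `(√(1 - α²) cos r, sin r)` with `r = s, t`.
  have hle : (1 - α ^ 2) * (Real.cos s * Real.cos t) + Real.sin s * Real.sin t ≤
      √((1 - (α * Real.cos s) ^ 2) * (1 - (α * Real.cos t) ^ 2)) := by
    refine Real.le_sqrt_of_sq_le ?_
    have h1 := Real.sin_sq_add_cos_sq s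
    have h2 := Real.sin_sq_add_cos_sq t
    have e1 : 1 - (α * Real.cos s) ^ 2 = (1 - α ^ 2) * Real.cos s ^ 2 + Real.sin s ^ 2 := by
      linear_combination -h1
    have e2 : 1 - (α * Real.cos t) ^ 2 = (1 - α ^ 2) * Real.cos t ^ 2 + Real.sin t ^ 2 := by
      linear_combination -h2
    rw [e1, e2]
    have := mul_nonneg (sub_nonneg.2 hα2)
      (sq_nonneg (Real.cos s * Real.sin t - Real.sin s * Real.cos t))
    nlinarith
  nlinarith

/-- The map `arccos u ↦ σ u` is 2-Lipschitz, and this factor 2 is why the angles use `C (2 k)`, of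
angular density `π / (4 k)`. -/
theorem IsCosDense.exists_sigmaMap {C : ℕ → Set ℝ} (hC : IsCosDense C) {k : ℕ} (hk : 0 < k) {b : ℝ}
    (hb : 0 < b) (hb' : b ≤ 2 * Real.pi) {θ : ℝ} (hθ : θ ∈ Set.Icc 0 b) :
    ∃ u ∈ C (2 * k), |sigmaMap 0 b u - θ| ≤ Real.pi / (2 * k) := by
  have hpi := Real.pi_pos
  have hα : 0 < Real.sin (b / 4) := Real.sin_pos_of_pos_of_lt_pi (by linarith) (by linarith)
  set v := Real.sin ((θ - b / 2) / 2) / Real.sin (b / 4) with hv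
  have hv1 : -1 ≤ v := by
    rw [hv, le_div_iff₀ hα, neg_one_mul, ← Real.sin_neg]
    exact Real.sin_le_sin_of_le_of_le_pi_div_two (by linarith) (by linarith [hθ.2])
      (by linarith [hθ.1])
  have hv2 : v ≤ 1 := by
    rw [hv, div_le_iff₀ hα, one_mul]
    exact Real.sin_le_sin_of_le_of_le_pi_div_two (by linarith [hθ.1]) (by linarith)
      (by linarith [hθ.2])
  have hmem : Real.arccos v ∈ Set.Icc 0 Real.pi := ⟨Real.arccos_nonneg v, Real.arccos_le_pi v⟩
  obtain ⟨s, hs, hsC, hsv⟩ := hC (2 * k) (by omega) _ hmem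
  refine ⟨_, hsC, ?_⟩
  have hθ' : θ = 2 * Real.arcsin (Real.sin (b / 4) * Real.cos (Real.arccos v)) + b / 2 := by
    rw [Real.cos_arccos hv1 hv2, hv, mul_div_cancel₀ _ hα.ne', Real.arcsin_sin
      (by linarith [hθ.1]) (by linarith [hθ.2])]
    ring
  have key := abs_arcsin_mul_cos_sub_le (Real.abs_sin_le_one (b / 4)) hs hmem
  rw [show sigmaMap 0 b (Real.cos s) - θ = 2 * (Real.arcsin (Real.sin (b / 4) * Real.cos s) -
    Real.arcsin (Real.sin (b / 4) * Real.cos (Real.arccos v))) by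
      conv_lhs => rw [hθ', sigmaMap]
      simp only [sub_zero, add_zero]
      ring, abs_mul, abs_two]
  have h4 : 2 * (Real.pi / (2 * ((2 * k : ℕ) : ℝ))) = Real.pi / (2 * k) := by
    push_cast
    field_simp
  rw [← h4]
  linarith

/-! ### Spherical coordinates: norm, symmetries, surjectivity. -/

/-- Extension of a finite tuple by zero to a sequence. -/
def extendZero {d : ℕ} (t : Fin d → ℝ) (i : ℕ) : ℝ := if h : i < d then t ⟨i, h⟩ else 0

theorem extendZero_of_lt {d : ℕ} (t : Fin d → ℝ) {i : ℕ} (h : i < d) :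
    extendZero t i = t ⟨i, h⟩ := dif_pos h

theorem extendZero_of_le {d : ℕ} (t : Fin d → ℝ) {i : ℕ} (h : d ≤ i) : extendZero t i = 0 :=
  dif_neg (by omega)

theorem extendZero_update {d : ℕ} (t : Fin d → ℝ) (j : Fin d) (a : ℝ) (i : ℕ) :
    extendZero (Function.update t j a) i = if i = j then a else extendZero t i := by
  unfold extendZero
  by_cases h : i < d
  · simp [h, Function.update_apply, Fin.ext_iff]
  · have : i ≠ j := by have := j.2; omega
    simp [h, this]

/-- The fictitious last angle `0` has cosine `1`, so one formula covers every Cartesian coordinate.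
-/
theorem sphericalMap_apply {d : ℕ} (t : Fin d → ℝ) (i : Fin d) :
    sphericalMap t i = t ⟨0, i.pos⟩ * Real.cos (extendZero t (i + 1)) *
      ∏ k ∈ Finset.range i, Real.sin (extendZero t (k + 1)) := by
  have hcos : (if h : i.val + 1 < d then Real.cos (t ⟨i.val + 1, h⟩) else 1) =
      Real.cos (extendZero t (i + 1)) := by
    unfold extendZero
    split_ifs <;> simp
  have hprod : ∏ k ∈ Finset.univ.filter (fun k : Fin d => 1 ≤ k.val ∧ k.val ≤ i.val),
      Real.sin (t k) = ∏ k ∈ Finset.range i, Real.sin (extendZero t (k + 1)) := by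
    symm
    refine Finset.prod_bij (fun k hk => ⟨k + 1, by have := Finset.mem_range.1 hk; omega⟩) ?_ ?_ ?_ ?_
    · intro k hk
      have := Finset.mem_range.1 hk
      simp only [Finset.mem_filter, Finset.mem_univ, true_and]
      omega
    · intro a _ b _ h
      simpa using h
    · intro b hb
      simp only [Finset.mem_filter, Finset.mem_univ, true_and] at hb
      exact ⟨b - 1, Finset.mem_range.2 (by omega), by ext; simp; omega⟩
    · intro k hk
      rw [extendZero_of_lt]
  rw [← hcos, ← hprod]
  rfl

theorem norm_sphericalMap {d : ℕ} (hd : 0 < d) (t : Fin d → ℝ) :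
    ‖sphericalMap t‖ = |t ⟨0, hd⟩| := by
  set r := t ⟨0, hd⟩
  set a : ℕ → ℝ := fun k => extendZero t (k + 1) with ha
  have key : ∀ N : ℕ, ∑ i ∈ Finset.range N,
      (r * Real.cos (a i) * ∏ k ∈ Finset.range i, Real.sin (a k)) ^ 2 +
      (r * ∏ k ∈ Finset.range N, Real.sin (a k)) ^ 2 = r ^ 2 := by
    intro N
    induction N with
    | zero => simp
    | succ N ih =>
      rw [Finset.sum_range_succ, Finset.prod_range_succ, ← ih]
      linear_combination (r * ∏ k ∈ Finset.range N, Real.sin (a k)) ^ 2 *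
        Real.sin_sq_add_cos_sq (a N)
  -- The fictitious angle contributes `sin 0 = 0`, which removes the remainder of the telescoping
  -- sum.
  have hlast : ∏ k ∈ Finset.range d, Real.sin (a k) = 0 := by
    refine Finset.prod_eq_zero (Finset.mem_range.2 (show d - 1 < d by omega)) ?_
    rw [ha]
    simp only
    rw [extendZero_of_le t (by omega), Real.sin_zero]
  have h := key d
  rw [hlast, mul_zero, zero_pow two_ne_zero, add_zero, ← Fin.sum_univ_eq_sum_range
    (fun i => (r * Real.cos (a i) * ∏ k ∈ Finset.range i, Real.sin (a k)) ^ 2)] at h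
  rw [EuclideanSpace.norm_eq, ← Real.sqrt_sq_eq_abs, ← h]
  congr 1
  refine Finset.sum_congr rfl fun i _ => ?_
  rw [sphericalMap_apply, Real.norm_eq_abs, sq_abs]

theorem sphericalMap_congr {d : ℕ} {t s : Fin d → ℝ} (h0 : ∀ i, i.val = 0 → t i = s i)
    (hc : ∀ i, i.val ≠ 0 → Real.cos (t i) = Real.cos (s i))
    (hs : ∀ i, i.val ≠ 0 → Real.sin (t i) = Real.sin (s i)) : sphericalMap t = sphericalMap s := by
  ext i
  rw [sphericalMap_apply, sphericalMap_apply, h0 _ rfl]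
  have hc' : ∀ k, Real.cos (extendZero t (k + 1)) = Real.cos (extendZero s (k + 1)) := by
    intro k
    unfold extendZero
    split_ifs
    · exact hc _ (by simp)
    · rfl
  have hs' : ∀ k, Real.sin (extendZero t (k + 1)) = Real.sin (extendZero s (k + 1)) := by
    intro k
    unfold extendZero
    split_ifs
    · exact hs _ (by simp)
    · rfl
  simp only [hc', hs']

/-- The sign of `sin θ_j` flips; adding `π` to the next angle flips its sine and cosine as well, and
the two signs cancel in every later coordinate. -/
theorem sphericalMap_reflect {d : ℕ} (t : Fin d → ℝ) {j j' : Fin d} (hj : j.val ≠ 0)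
    (hj' : j'.val = j.val + 1) :
    sphericalMap (Function.update (Function.update t j (-t j)) j' (t j' + Real.pi)) =
      sphericalMap t := by
  obtain ⟨q, hq⟩ := Nat.exists_eq_succ_of_ne_zero hj
  have e : extendZero t j.val = t j := extendZero_of_lt t j.2
  have e' : extendZero t j'.val = t j' := extendZero_of_lt t j'.2
  have hsin : ∀ k, Real.sin (extendZero (Function.update (Function.update t j (-t j)) j'
      (t j' + Real.pi)) (k + 1)) =
      (if k = q then -1 else 1) * (if k = q + 1 then -1 else 1) *
        Real.sin (extendZero t (k + 1)) := by
    intro k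
    rw [extendZero_update, extendZero_update]
    by_cases h1 : k = q
    · subst h1
      simp [hj', hq, ← e]
    · by_cases h2 : k = q + 1
      · subst h2
        simp [hj', hq, ← e', Real.sin_add_pi]
      · simp [hj', hq, h1, h2]
  have hcos : ∀ k, Real.cos (extendZero (Function.update (Function.update t j (-t j)) j'
      (t j' + Real.pi)) (k + 1)) =
      (if k = q + 1 then -1 else 1) * Real.cos (extendZero t (k + 1)) := by
    intro k
    rw [extendZero_update, extendZero_update]
    by_cases h1 : k = q
    · subst h1
      simp [hj', hq, ← e]
    · by_cases h2 : k = q + 1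
      · subst h2
        simp [hj', hq, ← e', Real.cos_add_pi]
      · simp [hj', hq, h1, h2]
  ext i
  have h0 : Function.update (Function.update t j (-t j)) j' (t j' + Real.pi) ⟨0, i.pos⟩ =
      t ⟨0, i.pos⟩ := by
    rw [Function.update_of_ne, Function.update_of_ne] <;> rw [Ne, Fin.ext_iff] <;> simp <;> omega
  rw [sphericalMap_apply, sphericalMap_apply, h0, hcos]
  simp only [hsin, Finset.prod_mul_distrib, Finset.prod_ite_eq', Finset.mem_range]
  rcases lt_trichotomy i.val (q + 1) with h | h | h
  · rw [if_neg (by omega), if_neg (by omega), if_neg (by omega)]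
    ring
  · rw [if_pos (by omega), if_pos (by omega), if_neg (by omega)]
    ring
  · rw [if_neg (by omega), if_pos (by omega), if_pos (by omega)]
    ring

/-- A given angle enters each Cartesian coordinate through at most one factor, a sine or a cosine.
-/
theorem isTrigPoly_sphericalMap_update {d : ℕ} (t : Fin d → ℝ) {j : Fin d} (hj : j.val ≠ 0)
    (i : Fin d) : IsTrigPoly 1 fun θ => sphericalMap (Function.update t j θ) i := by
  have h0 : ∀ θ, Function.update t j θ ⟨0, i.pos⟩ = t ⟨0, i.pos⟩ := fun θ => by
    rw [Function.update_of_ne]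
    rw [Ne, Fin.ext_iff]
    exact fun h => hj h.symm
  obtain ⟨q, hq⟩ := Nat.exists_eq_succ_of_ne_zero hj
  simp only [sphericalMap_apply, h0, extendZero_update, mul_assoc]
  refine IsTrigPoly.const_mul ?_ _
  have hc : IsTrigPoly (if i.val = q then 1 else 0) fun θ =>
      Real.cos (if i.val + 1 = j then θ else extendZero t (i + 1)) := by
    simp only [hq, Nat.succ_eq_add_one, add_left_inj]
    split_ifs
    · exact IsTrigPoly.cos
    · exact IsTrigPoly.const _
  have hs : ∀ k ∈ Finset.range i, IsTrigPoly (if k = q then 1 else 0) fun θ =>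
      Real.sin (if k + 1 = j then θ else extendZero t (k + 1)) := by
    intro k _
    simp only [hq, Nat.succ_eq_add_one, add_left_inj]
    split_ifs
    · exact IsTrigPoly.sin
    · exact IsTrigPoly.const _
  refine (hc.mul (IsTrigPoly.prod _ hs)).mono ?_
  simp only [Finset.sum_ite_eq', Finset.mem_range]
  split_ifs <;> omega

/-- With `ρ i` the norm of the tail `(X i, …, X (d - 1))`, the complex number `X i + i ρ (i + 1)`
has modulus `ρ i`, and its argument is the next angle. The last `ρ` keeps the sign of the last
coordinate, so the final angle covers the full circle. -/
theorem exists_sphericalMap_eq {d : ℕ} (hd : 2 ≤ d) (x : EuclideanSpace ℝ (Fin d)) :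
    ∃ t : Fin d → ℝ, 0 ≤ t ⟨0, by omega⟩ ∧ sphericalMap t = x := by
  set X : ℕ → ℝ := extendZero fun i => x i with hX
  set ρ : ℕ → ℝ := fun i => if i + 1 = d then X i else √(∑ l ∈ Finset.Ico i d, X l ^ 2) with hρ
  have hρ0 : ∀ i, i + 1 < d → 0 ≤ ρ i := fun i hi => by
    simp only [hρ]
    rw [if_neg (by omega)]
    exact Real.sqrt_nonneg _
  have hρ2 : ∀ i, i < d → ρ i ^ 2 = ∑ l ∈ Finset.Ico i d, X l ^ 2 := fun i hi => by
    simp only [hρ]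
    split_ifs with h
    · subst h
      simp
    · exact Real.sq_sqrt (Finset.sum_nonneg fun _ _ => sq_nonneg _)
  have hnorm : ∀ i, i + 1 < d → ‖(⟨X i, ρ (i + 1)⟩ : ℂ)‖ = ρ i := fun i hi => by
    rw [← sq_eq_sq₀ (norm_nonneg _) (hρ0 i hi), Complex.sq_norm, Complex.normSq_mk, ← sq, ← sq,
      hρ2 _ hi, hρ2 _ (by omega), Finset.sum_eq_sum_Ico_succ_bot (by omega : i < d)]
  set t : Fin d → ℝ := fun k => if k.val = 0 then ρ 0 else
    Complex.arg ⟨X (k.val - 1), ρ k.val⟩ with ht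
  have htk : ∀ k, k + 1 < d → extendZero t (k + 1) = Complex.arg ⟨X k, ρ (k + 1)⟩ := fun k hk => by
    rw [extendZero_of_lt t hk]
    simp [ht]
  have hsin : ∀ k, k + 1 < d → ρ k * Real.sin (extendZero t (k + 1)) = ρ (k + 1) := fun k hk => by
    rw [htk k hk, ← hnorm k hk, Complex.norm_mul_sin_arg]
  have hcos : ∀ k, k + 1 < d → ρ k * Real.cos (extendZero t (k + 1)) = X k := fun k hk => by
    rw [htk k hk, ← hnorm k hk, Complex.norm_mul_cos_arg]
  have hprod : ∀ i, i < d → ρ 0 * ∏ k ∈ Finset.range i, Real.sin (extendZero t (k + 1)) = ρ i := by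
    intro i
    induction i with
    | zero => simp
    | succ i ih =>
      intro hi
      rw [Finset.prod_range_succ, ← mul_assoc, ih (by omega), hsin i hi]
  refine ⟨t, by simpa [ht] using hρ0 0 (by omega), ?_⟩
  ext i
  have hXi : X i = x i := extendZero_of_lt _ i.2
  rw [sphericalMap_apply, mul_right_comm, show t ⟨0, i.pos⟩ = ρ 0 by simp [ht], hprod i i.2, ← hXi]
  by_cases h : i.val + 1 < d
  · exact hcos i h
  · rw [extendZero_of_le t (by omega), Real.cos_zero, mul_one]
    simp only [hρ]
    rw [if_pos (by omega)]

theorem continuous_sphericalMap {d : ℕ} : Continuous (sphericalMap : (Fin d → ℝ) → _) := by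
  unfold sphericalMap
  refine (PiLp.continuous_toLp 2 _).comp (continuous_pi fun i => ?_)
  refine Continuous.mul (Continuous.mul (by fun_prop) ?_) (by fun_prop)
  split_ifs <;> fun_prop

/-! ### The mesh in parameter space and constrained maximisers. -/

/-- The admissible values of the coordinate with index `i` of `S⁻¹` of the mesh. -/
def meshCoord (C : ℕ → Set ℝ) (d k i : ℕ) : Set ℝ :=
  if i = 0 then (fun u => u / 2 + 1 / 2) '' C k
  else if i + 1 = d then sigmaMap 0 (2 * Real.pi) '' C (2 * k)
  else sigmaMap 0 Real.pi '' C (2 * k)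

theorem sphericalMap_mem_ballMesh {C : ℕ → Set ℝ} {d k : ℕ} {t : Fin d → ℝ}
    (ht : ∀ i : Fin d, t i ∈ meshCoord C d k i) : sphericalMap t ∈ ballMesh C d k := by
  have : ∀ i : Fin d, ∃ u, u ∈ (if i.val = 0 then C k else C (2 * k)) ∧
      (if i.val = 0 then u / 2 + 1 / 2
        else if i.val + 1 = d then sigmaMap 0 (2 * Real.pi) u
        else sigmaMap 0 Real.pi u) = t i := by
    intro i
    have h := ht i
    unfold meshCoord at h
    split_ifs at h ⊢ <;> obtain ⟨u, hu, hu'⟩ := h <;> exact ⟨u, hu, hu'⟩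
  choose u hu hut using this
  refine ⟨u, hu, ?_⟩
  exact congrArg sphericalMap (funext fun i => hut i)

theorem ballMesh_subset_unitBall {C : ℕ → Set ℝ} {d k : ℕ} (hd : 0 < d)
    (hC : C k ⊆ Set.Icc (-1) 1) : ballMesh C d k ⊆ unitBall d := by
  rintro _ ⟨u, hu, rfl⟩
  have h := hC (by simpa using hu ⟨0, hd⟩)
  rw [mem_closedBall_zero_iff]
  simp only
  rw [norm_sphericalMap hd, paramMap, if_pos rfl, abs_le]
  constructor <;> linarith [h.1, h.2]

/-- Free angles can be reduced modulo `2π`, leaving a compact parameter set. The maximum is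
nevertheless over all real angles, as Riesz's inequality requires. -/
theorem exists_isMax_sphericalMap {d : ℕ} (hd : 0 < d) {g : EuclideanSpace ℝ (Fin d) → ℝ}
    (hg : Continuous g) (j : ℕ) {t : Fin d → ℝ} (ht : t ⟨0, hd⟩ ∈ Set.Icc (0 : ℝ) 1) :
    ∃ s : Fin d → ℝ, (∀ i, i.val < j → s i = t i) ∧ s ⟨0, hd⟩ ∈ Set.Icc (0 : ℝ) 1 ∧
      ∀ r : Fin d → ℝ, (∀ i, i.val < j → r i = t i) → r ⟨0, hd⟩ ∈ Set.Icc (0 : ℝ) 1 →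
        g (sphericalMap r) ≤ g (sphericalMap s) := by
  have hpi := Real.two_pi_pos
  let K : Set (Fin d → ℝ) := Set.pi Set.univ fun i =>
    if i.val < j then {t i} else if i.val = 0 then Set.Icc 0 1 else Set.Icc 0 (2 * Real.pi)
  have hK : IsCompact K := isCompact_univ_pi fun i => by
    split_ifs
    · exact isCompact_singleton
    · exact isCompact_Icc
    · exact isCompact_Icc
  have hred : ∀ r : Fin d → ℝ, (∀ i, i.val < j → r i = t i) → r ⟨0, hd⟩ ∈ Set.Icc (0 : ℝ) 1 →
      ∃ r' ∈ K, sphericalMap r' = sphericalMap r := by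
    intro r hr hr0
    refine ⟨fun i => if i.val < j then t i else if i.val = 0 then r i else
      toIcoMod hpi 0 (r i), fun i _ => ?_, sphericalMap_congr ?_ ?_ ?_⟩
    · simp only
      split_ifs with h1 h2
      · rfl
      · obtain rfl : i = ⟨0, hd⟩ := Fin.ext h2
        exact hr0
      · have := toIcoMod_mem_Ico hpi 0 (r i)
        rw [zero_add] at this
        exact Set.Ico_subset_Icc_self this
    · intro i hi
      split_ifs with h1
      · exact (hr i h1).symm
      · rfl
    · intro i hi
      split_ifs with h1
      · rw [hr i h1]
      · rw [toIcoMod, zsmul_eq_mul, Real.cos_sub_int_mul_two_pi]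
    · intro i hi
      split_ifs with h1
      · rw [hr i h1]
      · rw [toIcoMod, zsmul_eq_mul, Real.sin_sub_int_mul_two_pi]
  obtain ⟨t', ht', -⟩ := hred t (fun _ _ => rfl) ht
  obtain ⟨s, hs, hmax⟩ := hK.exists_isMaxOn ⟨t', ht'⟩
    (hg.comp continuous_sphericalMap).continuousOn
  refine ⟨s, fun i hi => ?_, ?_, fun r hr hr0 => ?_⟩
  · have := hs i trivial
    simp only [if_pos hi] at this
    exact this
  · have := hs ⟨0, hd⟩ trivial
    simp only [if_true] at this
    split_ifs at this with h
    · rw [Set.mem_singleton_iff.1 this]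
      exact ht
    · exact this
  · obtain ⟨r', hr', he⟩ := hred r hr hr0
    rw [← he]
    exact hmax hr'

theorem isTrigPoly_polyEval {d n : ℕ} (p : polySpace d n) {γ : ℝ → EuclideanSpace ℝ (Fin d)}
    (hγ : ∀ i, IsTrigPoly 1 fun θ => γ θ i) :
    IsTrigPoly n fun θ => polyEval (p : MvPolynomial (Fin d) ℝ) (γ θ) :=
  IsTrigPoly.mvPolynomial_eval ((MvPolynomial.mem_restrictTotalDegree _ _ _).1 p.2) hγ

theorem continuous_polyEval {d : ℕ} (p : MvPolynomial (Fin d) ℝ) :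
    Continuous fun x : EuclideanSpace ℝ (Fin d) => polyEval p x :=
  (MvPolynomial.continuous_eval p).comp (by fun_prop)

/-- The mesh only approximates angles in `[0, π]` (`[0, 2π]` for the last), so a maximiser needs a
representative there. Only coordinates of index at least `j` may change, since the earlier ones
already lie in the mesh. -/
theorem exists_angle_mem_Icc {d : ℕ} (t : Fin d → ℝ) {j : Fin d} (hj : j.val ≠ 0) :
    ∃ s : Fin d → ℝ, (∀ i < j, s i = t i) ∧ sphericalMap s = sphericalMap t ∧
      s j ∈ Set.Icc 0 (if j.val + 1 = d then 2 * Real.pi else Real.pi) := by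
  split_ifs with hjd
  · refine ⟨Function.update t j (toIcoMod Real.two_pi_pos 0 (t j)), fun i hi => ?_, ?_, ?_⟩
    · rw [Function.update_of_ne hi.ne]
    · refine sphericalMap_congr (fun i hi => ?_) (fun i _ => ?_) fun i _ => ?_
      · rw [Function.update_of_ne]
        rintro rfl
        exact hj hi
      · rw [Function.update_apply]
        split_ifs with h
        · rw [h, toIcoMod, zsmul_eq_mul, Real.cos_sub_int_mul_two_pi]
        · rfl
      · rw [Function.update_apply]
        split_ifs with h
        · rw [h, toIcoMod, zsmul_eq_mul, Real.sin_sub_int_mul_two_pi]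
        · rfl
    · have := toIcoMod_mem_Ico Real.two_pi_pos 0 (t j)
      rw [zero_add] at this
      rw [Function.update_self]
      exact Set.Ico_subset_Icc_self this
  · have main : ∀ t : Fin d → ℝ, 0 ≤ Real.sin (t j) → ∃ s : Fin d → ℝ, (∀ i < j, s i = t i) ∧
        sphericalMap s = sphericalMap t ∧ s j ∈ Set.Icc 0 Real.pi := by
      intro t hsin
      refine ⟨Function.update t j (Real.arccos (Real.cos (t j))), fun i hi => ?_, ?_, ?_⟩
      · rw [Function.update_of_ne hi.ne]
      · refine sphericalMap_congr (fun i hi => ?_) (fun i _ => ?_) fun i _ => ?_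
        · rw [Function.update_of_ne]
          rintro rfl
          exact hj hi
        · rw [Function.update_apply]
          split_ifs with h
          · rw [h, Real.cos_arccos (Real.neg_one_le_cos _) (Real.cos_le_one _)]
          · rfl
        · rw [Function.update_apply]
          split_ifs with h
          · rw [h, Real.sin_arccos, ← Real.sin_sq, Real.sqrt_sq hsin]
          · rfl
      · rw [Function.update_self]
        exact ⟨Real.arccos_nonneg _, Real.arccos_le_pi _⟩
    rcases le_total 0 (Real.sin (t j)) with h | h
    · exact main t h
    -- When `sin θ_j ≤ 0`, reflection makes it nonnegative at the expense of the next, still free,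
    -- angle.
    · let j' : Fin d := ⟨j + 1, by omega⟩
      have hlt : j < j' := by simp [j', Fin.lt_def]
      obtain ⟨s, hs, hst, hsj⟩ := main
        (Function.update (Function.update t j (-t j)) j' (t j' + Real.pi)) (by
          rw [Function.update_of_ne hlt.ne, Function.update_self, Real.sin_neg]
          linarith)
      refine ⟨s, fun i hi => ?_, ?_, hsj⟩
      · rw [hs i hi, Function.update_of_ne (hi.trans hlt).ne, Function.update_of_ne hi.ne]
      · rw [hst, sphericalMap_reflect t hj rfl]

/-! ### The norming inequality on the mesh. -/

section Mesh

variable {d n k : ℕ} {m : ℝ} {C : ℕ → Set ℝ}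

theorem cos_pi_div_pos (hm : 1 < m) : 0 < Real.cos (Real.pi / (2 * m)) := by
  have hpi := Real.pi_pos
  refine Real.cos_pos_of_mem_Ioo ⟨?_, ?_⟩
  · have : 0 < Real.pi / (2 * m) := by positivity
    linarith
  · rw [div_lt_div_iff₀ (by positivity) two_pos]
    nlinarith

theorem IsTrigPoly.abs_le_chebConst_mul (hn : 1 ≤ n) (hm : 1 < m) (hk : (k : ℝ) = m * n)
    {f : ℝ → ℝ} (hf : IsTrigPoly n f) {s θ : ℝ} (hb : ∀ θ, |f θ| ≤ |f s|)
    (h : |θ - s| ≤ Real.pi / (2 * k)) : |f s| ≤ chebConst m * |f θ| := by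
  have hpi := Real.pi_pos
  have hn' : (0 : ℝ) < n := by exact_mod_cast hn
  have hkn : (n : ℝ) < 2 * k := by rw [hk]; nlinarith
  have h1 := hf.mul_cos_le_of_isMax hn hb
    (h.trans_lt (div_lt_div_of_pos_left hpi hn' hkn))
  have hcos : Real.cos (Real.pi / (2 * m)) ≤ Real.cos (n * (θ - s)) := by
    rw [← Real.cos_abs (n * (θ - s)), abs_mul, abs_of_pos hn']
    refine Real.cos_le_cos_of_nonneg_of_le_pi (by positivity) ?_ ?_
    · exact div_le_self hpi.le (by linarith)
    · calc n * |θ - s| ≤ n * (Real.pi / (2 * k)) := mul_le_mul_of_nonneg_left h hn'.le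
        _ = Real.pi / (2 * m) := by
          rw [hk]
          field_simp
  rw [chebConst, div_mul_eq_mul_div, one_mul, le_div_iff₀ (cos_pi_div_pos hm)]
  exact (mul_le_mul_of_nonneg_left hcos (abs_nonneg _)).trans h1

/-- The substitution `r = (1 + cos τ) / 2` makes each Cartesian coordinate trigonometric of degree 1
in `τ` and keeps `r` in `[0, 1]` for all real `τ`. The maximum over the radius thus becomes a global
maximum in `τ`. -/
theorem exists_mesh_radius (hC : IsCosDense C) (hd : 0 < d) (hn : 1 ≤ n) (hm : 1 < m)
    (hk : (k : ℝ) = m * n) (p : polySpace d n) {t : Fin d → ℝ}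
    (ht0 : t ⟨0, hd⟩ ∈ Set.Icc (0 : ℝ) 1)
    (hmax : ∀ r ∈ Set.Icc (0 : ℝ) 1,
      |polyEval p.1 (sphericalMap (Function.update t ⟨0, hd⟩ r))| ≤
        |polyEval p.1 (sphericalMap t)|) :
    ∃ r ∈ meshCoord C d k 0, r ∈ Set.Icc (0 : ℝ) 1 ∧ |polyEval p.1 (sphericalMap t)| ≤
      chebConst m * |polyEval p.1 (sphericalMap (Function.update t ⟨0, hd⟩ r))| := by
  have hk0 : 0 < k := by
    have : (0 : ℝ) < k := by
      rw [hk]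
      have : (0 : ℝ) < n := by exact_mod_cast hn
      positivity
    exact_mod_cast this
  set τ := Real.arccos (2 * t ⟨0, hd⟩ - 1) with hτ
  have hcos : Real.cos τ = 2 * t ⟨0, hd⟩ - 1 :=
    Real.cos_arccos (by linarith [ht0.1]) (by linarith [ht0.2])
  obtain ⟨s, -, hsC, hs⟩ := hC k hk0 τ ⟨Real.arccos_nonneg _, Real.arccos_le_pi _⟩
  have hI : ∀ θ, Real.cos θ / 2 + 1 / 2 ∈ Set.Icc (0 : ℝ) 1 := fun θ =>
    ⟨by linarith [Real.neg_one_le_cos θ], by linarith [Real.cos_le_one θ]⟩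
  have htrig : IsTrigPoly n fun θ => polyEval p.1
      (sphericalMap (Function.update t ⟨0, hd⟩ (Real.cos θ / 2 + 1 / 2))) := by
    refine isTrigPoly_polyEval p fun i => ?_
    have e : ∀ θ, sphericalMap (Function.update t ⟨0, hd⟩ (Real.cos θ / 2 + 1 / 2)) i =
        (Real.cos (extendZero t (i + 1)) * (∏ l ∈ Finset.range i, Real.sin (extendZero t (l + 1))) / 2) *
          (Real.cos θ + 1) := by
      intro θ
      rw [sphericalMap_apply, Function.update_self]
      simp only [extendZero_update, Nat.succ_ne_zero, if_false]
      ring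
    simp only [e]
    exact (IsTrigPoly.cos.add ((IsTrigPoly.const 1).mono zero_le_one)).const_mul _
  have hτt : Function.update t ⟨0, hd⟩ (Real.cos τ / 2 + 1 / 2) = t := by
    rw [hcos, Function.update_eq_self_iff]
    ring
  have key := htrig.abs_le_chebConst_mul hn hm hk (s := τ) (θ := s) (fun θ => by
    rw [hτt]
    exact hmax _ (hI θ)) hs
  rw [hτt] at key
  exact ⟨_, by rw [meshCoord, if_pos rfl]; exact ⟨_, hsC, rfl⟩, hI s, key⟩

theorem exists_mesh_angle (hC : IsCosDense C) (hn : 1 ≤ n) (hm : 1 < m)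
    (hk : (k : ℝ) = m * n) (p : polySpace d n) {t : Fin d → ℝ} {j : Fin d} (hj : j.val ≠ 0)
    (htj : t j ∈ Set.Icc 0 (if j.val + 1 = d then 2 * Real.pi else Real.pi))
    (hmax : ∀ θ, |polyEval p.1 (sphericalMap (Function.update t j θ))| ≤
        |polyEval p.1 (sphericalMap t)|) :
    ∃ θ ∈ meshCoord C d k j, |polyEval p.1 (sphericalMap t)| ≤
      chebConst m * |polyEval p.1 (sphericalMap (Function.update t j θ))| := by
  have hpi := Real.pi_pos
  have hk0 : 0 < k := by
    have : (0 : ℝ) < k := by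
      rw [hk]
      have : (0 : ℝ) < n := by exact_mod_cast hn
      positivity
    exact_mod_cast this
  obtain ⟨θ, hθ, hθt⟩ : ∃ θ ∈ meshCoord C d k j, |θ - t j| ≤ Real.pi / (2 * k) := by
    rw [meshCoord, if_neg hj]
    split_ifs at htj ⊢
    · obtain ⟨u, hu, h⟩ := hC.exists_sigmaMap hk0 Real.two_pi_pos le_rfl htj
      exact ⟨_, ⟨u, hu, rfl⟩, h⟩
    · obtain ⟨u, hu, h⟩ := hC.exists_sigmaMap hk0 hpi (by linarith) htj
      exact ⟨_, ⟨u, hu, rfl⟩, h⟩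
  refine ⟨θ, hθ, ?_⟩
  have htrig : IsTrigPoly n fun θ => polyEval p.1 (sphericalMap (Function.update t j θ)) :=
    isTrigPoly_polyEval p (isTrigPoly_sphericalMap_update t hj)
  have key := htrig.abs_le_chebConst_mul hn hm hk (s := t j) (θ := θ) (fun θ => by
    rw [Function.update_eq_self]
    exact hmax θ) hθt
  rwa [Function.update_eq_self] at key

/-- Moving one more coordinate into the mesh costs a factor `c_m`. -/
theorem exists_mesh_step (hC : IsCosDense C) (hd : 0 < d) (hn : 1 ≤ n) (hm : 1 < m)
    (hk : (k : ℝ) = m * n) (p : polySpace d n) (j : Fin d) {t : Fin d → ℝ}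
    (ht0 : t ⟨0, hd⟩ ∈ Set.Icc (0 : ℝ) 1) :
    ∃ s : Fin d → ℝ, (∀ i < j, s i = t i) ∧ s ⟨0, hd⟩ ∈ Set.Icc (0 : ℝ) 1 ∧
      s j ∈ meshCoord C d k j ∧
      |polyEval p.1 (sphericalMap t)| ≤ chebConst m * |polyEval p.1 (sphericalMap s)| := by
  obtain ⟨r, hrt, hr0, hmax⟩ := exists_isMax_sphericalMap hd
    (g := fun x => |polyEval p.1 x|) (continuous_polyEval p.1).abs j ht0
  have htr := hmax t (fun _ _ => rfl) ht0
  rcases eq_or_ne j.val 0 with hj | hj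
  · obtain rfl : j = ⟨0, hd⟩ := Fin.ext hj
    obtain ⟨a, ha, haI, hle⟩ := exists_mesh_radius hC hd hn hm hk p hr0 fun a ha =>
      hmax _ (fun i hi => absurd hi (Nat.not_lt_zero _)) (by rwa [Function.update_self])
    refine ⟨_, fun i hi => absurd hi (Nat.not_lt_zero _), ?_, ?_, htr.trans hle⟩
    · rwa [Function.update_self]
    · rwa [Function.update_self]
  · have h0j : (⟨0, hd⟩ : Fin d) < j := Fin.lt_def.2 (Nat.pos_of_ne_zero hj)
    obtain ⟨q, hqr, hq, hqj⟩ := exists_angle_mem_Icc r hj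
    have hprefix : ∀ θ, ∀ i < j, Function.update q j θ i = t i := fun θ i hi => by
      rw [Function.update_of_ne hi.ne, hqr i hi, hrt i hi]
    have hzero : ∀ θ, Function.update q j θ ⟨0, hd⟩ ∈ Set.Icc (0 : ℝ) 1 := fun θ => by
      rw [Function.update_of_ne h0j.ne, hqr _ h0j]
      exact hr0
    -- Changing representative may alter later angles, but `r` was maximal over all of them, so `q`
    -- is still maximal in its `j`-th angle.
    obtain ⟨θ, hθ, hle⟩ := exists_mesh_angle hC hn hm hk p hj hqj fun θ => by
      rw [hq]
      exact hmax _ (hprefix θ) (hzero θ)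
    rw [hq] at hle
    exact ⟨_, hprefix θ, hzero θ, by rwa [Function.update_self], htr.trans hle⟩

/-- The mesh is a norming set for polynomials of degree at most `n` on the ball. -/
theorem exists_ballMesh_abs_le (hC : IsCosDense C) (hd : 2 ≤ d) (hn : 1 ≤ n) (hm : 1 < m)
    (hk : (k : ℝ) = m * n) (p : polySpace d n) {x : EuclideanSpace ℝ (Fin d)}
    (hx : x ∈ unitBall d) :
    ∃ y ∈ ballMesh C d k, |polyEval p.1 x| ≤ chebConst m ^ d * |polyEval p.1 y| := by
  have hd0 : 0 < d := by omega
  have hc : 0 ≤ chebConst m := one_div_nonneg.2 (cos_pi_div_pos hm).le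
  obtain ⟨t, ht0, rfl⟩ := exists_sphericalMap_eq hd x
  rw [mem_closedBall_zero_iff, norm_sphericalMap hd0, abs_of_nonneg ht0] at hx
  have main : ∀ j ≤ d, ∃ s : Fin d → ℝ, (∀ i : Fin d, i.val < j → s i ∈ meshCoord C d k i) ∧
      s ⟨0, hd0⟩ ∈ Set.Icc (0 : ℝ) 1 ∧
      |polyEval p.1 (sphericalMap t)| ≤ chebConst m ^ j * |polyEval p.1 (sphericalMap s)| := by
    intro j
    induction j with
    | zero => exact fun _ => ⟨t, fun i hi => absurd hi (Nat.not_lt_zero _), ⟨ht0, hx⟩, by simp⟩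
    | succ j ih =>
      intro hj
      obtain ⟨s, hs, hs0, hle⟩ := ih (by omega)
      obtain ⟨r, hrs, hr0, hrj, hle'⟩ := exists_mesh_step hC hd0 hn hm hk p ⟨j, hj⟩ hs0
      refine ⟨r, fun i hi => ?_, hr0, ?_⟩
      · rcases Nat.lt_succ_iff_lt_or_eq.1 hi with h | h
        · rw [hrs i h]
          exact hs i h
        · obtain rfl : i = ⟨j, hj⟩ := Fin.ext h
          exact hrj
      · rw [pow_succ, mul_assoc]
        exact hle.trans (mul_le_mul_of_nonneg_left hle' (pow_nonneg hc _))
  obtain ⟨s, hs, -, hle⟩ := main d le_rfl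
  exact ⟨_, sphericalMap_mem_ballMesh fun i => hs i i.2, hle⟩

end Mesh

/-! ### Lebesgue function and operator norm. -/

theorem abs_eq_ite_mul (a : ℝ) : |a| = (if 0 ≤ a then 1 else -1) * a := by
  split_ifs with h
  · rw [abs_of_nonneg h, one_mul]
  · rw [abs_of_neg (not_le.1 h), neg_one_mul]

theorem abs_sum_mul_le_sum_abs {ι : Type*} (s : Finset ι) {a b : ι → ℝ} {c : ℝ}
    (ha : ∀ i ∈ s, |a i| ≤ c) : |∑ i ∈ s, a i * b i| ≤ c * ∑ i ∈ s, |b i| := by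
  rw [Finset.mul_sum]
  refine (Finset.abs_sum_le_sum_abs _ _).trans (Finset.sum_le_sum fun i hi => ?_)
  rw [abs_mul]
  exact mul_le_mul_of_nonneg_right (ha i hi) (abs_nonneg _)

theorem supNormOn_nonneg {α : Type*} (Y : Set α) (g : α → ℝ) : 0 ≤ supNormOn Y g := by
  refine Real.sSup_nonneg ?_
  rintro _ ⟨x, -, rfl⟩
  exact abs_nonneg _

theorem abs_le_supNormOn {α : Type*} {Y : Set α} {g : α → ℝ}
    (h : BddAbove ((fun x => |g x|) '' Y)) {x : α} (hx : x ∈ Y) : |g x| ≤ supNormOn Y g :=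
  le_csSup h ⟨x, hx, rfl⟩

theorem supNormOn_le {α : Type*} {Y : Set α} {g : α → ℝ} {c : ℝ} (hc : 0 ≤ c)
    (h : ∀ x ∈ Y, |g x| ≤ c) : supNormOn Y g ≤ c := by
  refine Real.sSup_le ?_ hc
  rintro _ ⟨x, hx, rfl⟩
  exact h x hx

section Lebesgue

variable {d n M : ℕ} (φ : Fin M → polySpace d n)

theorem lebesgueFn_nonneg (x : EuclideanSpace ℝ (Fin d)) : 0 ≤ lebesgueFn φ x :=
  Finset.sum_nonneg fun _ _ => abs_nonneg _

theorem continuous_lebesgueFn : Continuous (lebesgueFn φ) :=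
  continuous_finsetSum _ fun _ _ => (continuous_polyEval _).abs

theorem bddAbove_lebesgueFn : BddAbove ((fun x => |lebesgueFn φ x|) '' unitBall d) :=
  ((isCompact_closedBall _ _).image (continuous_lebesgueFn φ).abs).bddAbove

theorem lebesgueFn_le_supNormOn {Y : Set (EuclideanSpace ℝ (Fin d))} (hY : Y ⊆ unitBall d)
    {x : EuclideanSpace ℝ (Fin d)} (hx : x ∈ Y) : lebesgueFn φ x ≤ supNormOn Y (lebesgueFn φ) :=
  (le_abs_self _).trans
    (abs_le_supNormOn ((bddAbove_lebesgueFn φ).mono (Set.image_mono hY)) hx)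

theorem supNormOn_unitBall_le {C : ℕ → Set ℝ} {k : ℕ} {m : ℝ} (hC : IsCosDense C)
    (hC' : C k ⊆ Set.Icc (-1) 1) (hd : 2 ≤ d) (hn : 1 ≤ n) (hm : 1 < m) (hk : (k : ℝ) = m * n) :
    supNormOn (unitBall d) (lebesgueFn φ) ≤
      chebConst m ^ d * supNormOn (ballMesh C d k) (lebesgueFn φ) := by
  have hc : 0 ≤ chebConst m ^ d := pow_nonneg (one_div_nonneg.2 (cos_pi_div_pos hm).le) _
  refine supNormOn_le (mul_nonneg hc (supNormOn_nonneg _ _)) fun x hx => ?_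
  rw [abs_of_nonneg (lebesgueFn_nonneg φ x)]
  -- These signs make `∑ ε i φ i` equal to the Lebesgue function at `x` and bounded by it
  -- everywhere.
  set ε : Fin M → ℝ := fun i => if 0 ≤ polyEval (φ i).1 x then 1 else -1 with hε
  have heval : ∀ y, polyEval (∑ i, ε i • φ i : polySpace d n).1 y =
      ∑ i, ε i * polyEval (φ i).1 y := fun y => by
    simp [polyEval]
  obtain ⟨y, hy, hle⟩ := exists_ballMesh_abs_le hC hd hn hm hk (∑ i, ε i • φ i) hx
  rw [heval, heval] at hle
  have h1 : lebesgueFn φ x = ∑ i, ε i * polyEval (φ i).1 x :=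
    Finset.sum_congr rfl fun i _ => abs_eq_ite_mul _
  have h2 : |∑ i, ε i * polyEval (φ i).1 y| ≤ lebesgueFn φ y := by
    refine (abs_sum_mul_le_sum_abs Finset.univ (c := 1) fun i _ => ?_).trans_eq (one_mul _)
    simp only [hε]
    split_ifs <;> simp
  rw [h1]
  refine (le_abs_self _).trans (hle.trans (mul_le_mul_of_nonneg_left (h2.trans ?_) hc))
  exact lebesgueFn_le_supNormOn φ (ballMesh_subset_unitBall (by omega) hC') hy

variable {φ} {ξ : Fin M → unitBall d} {L : C(unitBall d, ℝ) →ₗ[ℝ] polySpace d n}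

theorem normQuotient_le (hL : ∀ (f : C(unitBall d, ℝ)) (x : unitBall d),
      polyEval (L f : MvPolynomial (Fin d) ℝ) x.1 =
        ∑ i, f (ξ i) * polyEval (φ i : MvPolynomial (Fin d) ℝ) x.1) :
    ∀ q ∈ normQuotients L, q ≤ supNormOn (unitBall d) (lebesgueFn φ) := by
  rintro _ ⟨f, hf, rfl⟩
  rw [div_le_iff₀ (norm_pos_iff.2 hf), ContinuousMap.norm_le _
    (mul_nonneg (supNormOn_nonneg _ _) (norm_nonneg _))]
  intro x
  rw [Real.norm_eq_abs, mul_comm]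
  change |polyEval (L f).1 x.1| ≤ _
  rw [hL]
  exact (abs_sum_mul_le_sum_abs Finset.univ fun i _ => f.norm_coe_le_norm (ξ i)).trans
    (mul_le_mul_of_nonneg_left (lebesgueFn_le_supNormOn φ subset_rfl x.2) (norm_nonneg f))

theorem supNormOn_le_lebesgueConst (hξ : Function.Injective ξ)
    (hL : ∀ (f : C(unitBall d, ℝ)) (x : unitBall d),
      polyEval (L f : MvPolynomial (Fin d) ℝ) x.1 =
        ∑ i, f (ξ i) * polyEval (φ i : MvPolynomial (Fin d) ℝ) x.1) :
    supNormOn (unitBall d) (lebesgueFn φ) ≤ lebesgueConst L := by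
  have h0 : 0 ≤ lebesgueConst L := by
    refine Real.sSup_nonneg ?_
    rintro _ ⟨f, -, rfl⟩
    positivity
  refine supNormOn_le h0 fun x hx => ?_
  rw [abs_of_nonneg (lebesgueFn_nonneg φ x)]
  have he : Topology.IsClosedEmbedding ξ :=
    Topology.IsClosedEmbedding.of_continuous_injective_isClosedMap continuous_of_discreteTopology
      hξ fun s _ => (s.toFinite.image ξ).isClosed
  -- Tietze extension: distinct nodes allow arbitrary signs to be interpolated by a function with
  -- values in `[-1, 1]`.
  obtain ⟨f, hf, hfξ⟩ := ContinuousMap.exists_extension_forall_mem_of_isClosedEmbedding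
    (⟨fun i => if 0 ≤ polyEval (φ i).1 x then (1 : ℝ) else -1, continuous_of_discreteTopology⟩ :
      C(Fin M, ℝ)) (t := Set.Icc (-1) 1)
    (fun i => by simp only [ContinuousMap.coe_mk]; split_ifs <;> norm_num)
    ⟨0, by norm_num⟩ he
  have hval : polyEval (L f).1 x = lebesgueFn φ x := by
    refine (hL f ⟨x, hx⟩).trans (Finset.sum_congr rfl fun i _ => ?_)
    rw [abs_eq_ite_mul, show f (ξ i) = _ from congrFun hfξ i]
    rfl
  have hnorm : ‖f‖ ≤ 1 := (ContinuousMap.norm_le _ zero_le_one).2 fun y => abs_le.2 (hf y)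
  have hle : lebesgueFn φ x ≤ ‖polyOnBall (L f).1‖ := by
    rw [← hval]
    exact (le_abs_self _).trans ((polyOnBall (L f).1).norm_coe_le_norm ⟨x, hx⟩)
  -- The function `f` takes values `±1` at the nodes, so it can vanish only when there are none.
  rcases eq_or_ne f 0 with rfl | hf0
  · have : lebesgueFn φ x = 0 := by
      rw [← hval, map_zero]
      simp [polyEval]
    rwa [this]
  · refine hle.trans (le_trans ?_ (le_csSup ⟨_, normQuotient_le hL⟩ ⟨f, hf0, rfl⟩))
    exact le_div_self (norm_nonneg _) (norm_pos_iff.2 hf0) hnorm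

end Lebesgue

theorem proposition3
    (d : ℕ) (hd : 2 ≤ d) (n : ℕ) (hn : 1 ≤ n)
    -- the fineness parameter `m > 1`, with `k = m n` an integer
    (m : ℝ) (hm : 1 < m) (k : ℕ) (hk : (k : ℝ) = m * n)
    -- Chebyshev or Chebyshev-Lobatto points
    (C : ℕ → Set ℝ) (hC : C = chebZeros ∨ C = chebExtrema)
    -- distinct nodes in the ball and a set of generators of the polynomial space
    (M : ℕ) (ξ : Fin M → unitBall d) (hξ : Function.Injective ξ)
    (φ : Fin M → polySpace d n) (hφ : Submodule.span ℝ (Set.range φ) = ⊤)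
    -- a linear projection onto the polynomial space, of the form `∑ i, f (ξ i) φ i`
    (L : C(unitBall d, ℝ) →ₗ[ℝ] polySpace d n)
    (hL : ∀ (f : C(unitBall d, ℝ)) (x : unitBall d),
      polyEval (L f : MvPolynomial (Fin d) ℝ) x.1 =
        ∑ i, f (ξ i) * polyEval (φ i : MvPolynomial (Fin d) ℝ) x.1)
    (hproj : ∀ p : polySpace d n, L (polyOnBall (p : MvPolynomial (Fin d) ℝ)) = p) :
    BddAbove (normQuotients L) ∧
    lebesgueConst L = supNormOn (unitBall d) (lebesgueFn φ) ∧
    supNormOn (ballMesh C d k) (lebesgueFn φ) ≤ lebesgueConst L ∧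
    lebesgueConst L ≤ chebConst m ^ d * supNormOn (ballMesh C d k) (lebesgueFn φ) := by
  have hdense : IsCosDense C := by
    rcases hC with rfl | rfl
    exacts [isCosDense_chebZeros, isCosDense_chebExtrema]
  have hsub : C k ⊆ Set.Icc (-1) 1 := by
    rcases hC with rfl | rfl
    exacts [chebZeros_subset k, chebExtrema_subset k]
  have heq : lebesgueConst L = supNormOn (unitBall d) (lebesgueFn φ) :=
    le_antisymm (Real.sSup_le (normQuotient_le hL) (supNormOn_nonneg _ _))
      (supNormOn_le_lebesgueConst hξ hL)
  have hmesh := ballMesh_subset_unitBall (by omega : 0 < d) hsub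
  refine ⟨⟨_, normQuotient_le hL⟩, heq, ?_, ?_⟩
  · rw [heq]
    refine supNormOn_le (supNormOn_nonneg _ _) fun x hx => ?_
    exact abs_le_supNormOn (bddAbove_lebesgueFn φ) (hmesh hx)
  · rw [heq]
    exact supNormOn_unitBall_le φ hdense hsub hd hn hm hk
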